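/- Let $A$ and $B$ be normal $n\times n$ complex matrices, and let $f:[0,\infty)\to[0,\infty)$ be a concave function that is e-convex, i.e. such that $t\mapsto f(e^t)$ is convex on $(-\infty,\infty)$. Then, for every symmetric norm $\|\cdot\|$ on the $n\times n$ complex matrices, i.e. every norm such that $\|UXV\|=\|X\|$ for all matrices $X$ and all unitary matrices $U,V$, $$\|f(|A+B|)\|\le\|f(|A|)+f(|B|)\|.$$ Here $|X|=(X^*X)^{1/2}$, and $f(X)$ is defined by the functional calculus for positive semidefinite $X$. Continuity of $f$ at $0$ is not assumed. -/

import Mathlib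

open scoped MatrixOrder

/-- A function `f` on `[0, ∞)` is e-convex if `t ↦ f (e ^ t)` is convex on the whole real line.
Only the values of `f` on `(0, ∞)` matter. -/
def EConvex (f : ℝ → ℝ) : Prop :=
  ConvexOn ℝ Set.univ (fun t : ℝ => f (Real.exp t))

/-- A symmetric (that is, unitarily invariant) norm on square complex matrices: a norm `N`
(a definite seminorm) with `N (U * A * V) = N A` for all matrices `A` and all unitaries `U`, `V`. -/
structure IsSymmetricNorm {n : Type*} [Fintype n] [DecidableEq n]
    (N : Seminorm ℂ (Matrix n n ℂ)) : Prop where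
  eq_zero_of_map_eq_zero : ∀ A : Matrix n n ℂ, N A = 0 → A = 0
  map_unitary_mul_mul_unitary : ∀ (A : Matrix n n ℂ), ∀ U ∈ Matrix.unitaryGroup n ℂ,
    ∀ V ∈ Matrix.unitaryGroup n ℂ, N (U * A * V) = N A

/-! Everything is measured by `excess r X`, the trace of `(X - r)₊`, which is the maximum of `Tr (E
X) - r Tr E` over `0 ≤ E ≤ 1`, attained at a spectral projection. Domination of `excess r` for all
`r ≥ 0` is weak majorization, and symmetric norms respect it (`IsSymmetricNorm.le_of_excess_le`).

Positive case (`excess_cfc_add_le`): on finitely many points a concave `f` with `f 0 = 0` is a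
nonnegative combination of `min t a = t - (t - a)₊`, so it suffices to treat truncations. The core
is `excess_truncSub_add_le`: `(A - a)₊ + (B - a)₊` has excess over `r` at most that of `A + B` over
`a + r`. Working with a finite set of points makes continuity of `f` irrelevant.

Normal case (`excess_cfc_abs_add_le`): the Hermitian dilation has eigenvalues plus and minus the
singular values. The dilation of `A + B` lies below the sum of the positive parts of the dilations
of `A` and `B`, so Weyl monotonicity reduces to the positive case. Normality makes both diagonal
blocks of `f` of a positive part equal to `f |A| / 2`, and a positive block matrix with equal
diagonal blocks is weakly majorized by their sum. A nonzero `f 0` is removed at the end by a shift.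
-/

open Matrix
open scoped ComplexOrder

set_option linter.unusedSectionVars false

/-! ### Trace inequalities, functional calculus and the excess functional. -/

section RealTrace

variable {m n : Type*} [Fintype m] [DecidableEq m] [Fintype n] [DecidableEq n]

/-- The real part of the trace of a complex matrix, as a real-linear functional. -/
noncomputable def reTrace : Matrix n n ℂ →ₗ[ℝ] ℝ where
  toFun X := X.trace.re
  map_add' X Y := by simp
  map_smul' c X := by simp

theorem reTrace_apply (X : Matrix n n ℂ) : reTrace X = X.trace.re := rfl

theorem reTrace_mul_comm (X : Matrix m n ℂ) (Y : Matrix n m ℂ) :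
    reTrace (X * Y) = reTrace (Y * X) := by
  simp only [reTrace_apply, trace_mul_comm X Y]

theorem reTrace_nonneg {P : Matrix n n ℂ} (hP : P.PosSemidef) : 0 ≤ reTrace P :=
  (Complex.le_def.1 hP.trace_nonneg).1

theorem reTrace_mul_nonneg {P Q : Matrix n n ℂ} (hP : P.PosSemidef) (hQ : Q.PosSemidef) :
    0 ≤ reTrace (P * Q) := by
  obtain ⟨B, rfl⟩ := CStarAlgebra.nonneg_iff_eq_star_mul_self.1 hP.nonneg
  rw [mul_assoc, reTrace_mul_comm]
  exact reTrace_nonneg (hQ.mul_mul_conjTranspose_same B)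

theorem reTrace_mul_le {P X Y : Matrix n n ℂ} (hP : P.PosSemidef) (h : (Y - X).PosSemidef) :
    reTrace (P * X) ≤ reTrace (P * Y) := by
  have := reTrace_mul_nonneg hP h
  rw [mul_sub, map_sub] at this
  linarith

theorem continuousOn_spectrum (f : ℝ → ℝ) (X : Matrix n n ℂ) : ContinuousOn f (spectrum ℝ X) :=
  X.finite_real_spectrum.continuousOn f

theorem matrix_cfc_mul (f g : ℝ → ℝ) (X : Matrix n n ℂ) :
    cfc (fun t => f t * g t) X = cfc f X * cfc g X :=
  cfc_mul f g X (continuousOn_spectrum f X) (continuousOn_spectrum g X)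

theorem matrix_cfc_add (f g : ℝ → ℝ) (X : Matrix n n ℂ) :
    cfc (fun t => f t + g t) X = cfc f X + cfc g X :=
  cfc_add f g (a := X) (continuousOn_spectrum f X) (continuousOn_spectrum g X)

theorem matrix_cfc_sub (f g : ℝ → ℝ) (X : Matrix n n ℂ) :
    cfc (fun t => f t - g t) X = cfc f X - cfc g X :=
  cfc_sub f g X (continuousOn_spectrum f X) (continuousOn_spectrum g X)

theorem matrix_cfc_const_mul (c : ℝ) (f : ℝ → ℝ) (X : Matrix n n ℂ) :
    cfc (fun t => c * f t) X = c • cfc f X :=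
  cfc_const_mul c f X (continuousOn_spectrum f X)

theorem matrix_cfc_comp (g f : ℝ → ℝ) {X : Matrix n n ℂ} (hX : X.IsHermitian) :
    cfc (fun t => g (f t)) X = cfc g (cfc f X) :=
  cfc_comp' g f X ((X.finite_real_spectrum.image f).continuousOn g) (continuousOn_spectrum f X)
    hX.isSelfAdjoint

theorem matrix_cfc_const (c : ℝ) {X : Matrix n n ℂ} (hX : X.IsHermitian) :
    cfc (fun _ => c) X = c • (1 : Matrix n n ℂ) := by
  rw [cfc_const c X hX.isSelfAdjoint, Algebra.algebraMap_eq_smul_one]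

theorem matrix_cfc_id {X : Matrix n n ℂ} (hX : X.IsHermitian) : cfc (fun t : ℝ => t) X = X :=
  cfc_id' ℝ X hX.isSelfAdjoint

theorem isHermitian_cfc (f : ℝ → ℝ) (X : Matrix n n ℂ) : (cfc f X).IsHermitian :=
  cfc_predicate f X

theorem spectrum_nonneg {X : Matrix n n ℂ} (hX : X.PosSemidef) {t : ℝ} (ht : t ∈ spectrum ℝ X) :
    0 ≤ t :=
  spectrum_nonneg_of_nonneg hX.nonneg ht

theorem posSemidef_cfc {f : ℝ → ℝ} {X : Matrix n n ℂ} (hf : ∀ t ∈ spectrum ℝ X, 0 ≤ f t) :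
    (cfc f X).PosSemidef :=
  nonneg_iff_posSemidef.1 (cfc_nonneg hf)

theorem posSemidef_cfc_sub {f g : ℝ → ℝ} {X : Matrix n n ℂ}
    (hf : ∀ t ∈ spectrum ℝ X, f t ≤ g t) : (cfc g X - cfc f X).PosSemidef := by
  rw [← matrix_cfc_sub]
  exact posSemidef_cfc fun t ht => sub_nonneg.2 (hf t ht)

/-- `∑ (λ - r)₊` over the eigenvalues `λ` of a Hermitian matrix. -/
noncomputable def excess (r : ℝ) (X : Matrix n n ℂ) : ℝ :=
  reTrace (cfc (fun t => max (t - r) 0) X)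

/-- The spectral projection of a Hermitian matrix onto `(s, ∞)`. -/
noncomputable def upperProj (s : ℝ) (X : Matrix n n ℂ) : Matrix n n ℂ :=
  cfc (fun t => if s < t then 1 else 0) X

theorem posSemidef_upperProj (s : ℝ) (X : Matrix n n ℂ) : (upperProj s X).PosSemidef :=
  posSemidef_cfc fun t _ => by split_ifs <;> norm_num

theorem posSemidef_one_sub_upperProj (s : ℝ) {X : Matrix n n ℂ} (hX : X.IsHermitian) :
    (1 - upperProj s X).PosSemidef := by
  have h : (1 : Matrix n n ℂ) = cfc (fun _ : ℝ => (1 : ℝ)) X := by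
    rw [matrix_cfc_const 1 hX, one_smul]
  rw [h]
  exact posSemidef_cfc_sub fun t _ => by split_ifs <;> norm_num

/-- Since `X - r ≤ (X - r)₊` and `E ≤ 1`, `Tr E (X - r) ≤ Tr E (X - r)₊ ≤ Tr (X - r)₊`. Together
with `excess_eq_reTrace` this is the variational formula for the excess. -/
theorem reTrace_effect_le_excess (r : ℝ) {E X : Matrix n n ℂ} (hX : X.IsHermitian)
    (hE : E.PosSemidef) (hE' : (1 - E).PosSemidef) :
    reTrace (E * X) - r * reTrace E ≤ excess r X := by
  have h1 : (cfc (fun t => max (t - r) 0) X).PosSemidef :=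
    posSemidef_cfc fun t _ => le_max_right _ _
  have h2 := reTrace_mul_nonneg hE' h1
  have h3 : reTrace (E * cfc (fun t : ℝ => t - r) X) ≤
      reTrace (E * cfc (fun t => max (t - r) 0) X) :=
    reTrace_mul_le hE (posSemidef_cfc_sub fun t _ => le_max_left _ _)
  rw [matrix_cfc_sub, matrix_cfc_id hX, matrix_cfc_const r hX, mul_sub, mul_smul_comm, mul_one,
    map_sub, map_smul, smul_eq_mul] at h3
  rw [sub_mul, one_mul, map_sub] at h2
  rw [excess]
  linarith

theorem excess_eq_reTrace (r : ℝ) {X : Matrix n n ℂ} (hX : X.IsHermitian) :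
    excess r X = reTrace (upperProj r X * X) - r * reTrace (upperProj r X) := by
  have h : cfc (fun t => max (t - r) 0) X =
      cfc (fun t => (if r < t then 1 else 0) * t - r * (if r < t then 1 else 0)) X := by
    refine cfc_congr fun t _ => ?_
    split_ifs with h
    · rw [max_eq_left (by linarith)]; ring
    · rw [max_eq_right (by linarith)]; ring
  rw [excess, h, matrix_cfc_sub, matrix_cfc_mul, matrix_cfc_id hX, matrix_cfc_const_mul, map_sub,
    map_smul]
  rfl

theorem excess_of_nonpos {r : ℝ} (hr : r ≤ 0) {X : Matrix n n ℂ} (hX : X.PosSemidef) :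
    excess r X = reTrace X - r * Fintype.card n := by
  have h : cfc (fun t => max (t - r) 0) X = cfc (fun t => t - r) X :=
    cfc_congr fun t ht => max_eq_left (by linarith [spectrum_nonneg hX ht])
  rw [excess, h, matrix_cfc_sub, matrix_cfc_id hX.isHermitian, matrix_cfc_const r hX.isHermitian,
    map_sub, map_smul, smul_eq_mul, reTrace_apply (1 : Matrix n n ℂ)]
  simp

theorem excess_add_smul_one (r c : ℝ) {X : Matrix n n ℂ} (hX : X.IsHermitian) :
    excess r (X + c • (1 : Matrix n n ℂ)) = excess (r - c) X := by
  have h : X + c • (1 : Matrix n n ℂ) = cfc (fun t : ℝ => t + c) X := by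
    rw [matrix_cfc_add, matrix_cfc_id hX, matrix_cfc_const c hX]
  rw [excess, h, ← matrix_cfc_comp (fun t => max (t - r) 0) _ hX, excess]
  congr 3
  ext t
  ring_nf

/-- The two matrices are the two Schur complements of the block matrix with identity diagonal blocks
and off-diagonal blocks `K`, `Kᴴ`. -/
theorem posSemidef_one_sub_conjTranspose_mul {K : Matrix m n ℂ}
    (h : (1 - K * Kᴴ).PosSemidef) : (1 - Kᴴ * K).PosSemidef := by
  let _ : Invertible (1 : Matrix m m ℂ) := invertibleOne
  let _ : Invertible (1 : Matrix n n ℂ) := invertibleOne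
  have h1 := PosDef.fromBlocks₁₁ K (1 : Matrix n n ℂ) (PosDef.one (n := m) (R := ℂ))
  have h2 := PosDef.fromBlocks₂₂ (1 : Matrix m m ℂ) K (PosDef.one (n := n) (R := ℂ))
  rw [inv_one, Matrix.mul_one] at h1 h2
  exact h1.1 (h2.2 h)

end RealTrace

/-! ### Truncations of a sum of positive matrices. -/

section Subadditivity

variable {n : Type*} [Fintype n] [DecidableEq n]

/-- The positive part `(X - a)₊` of a shifted Hermitian matrix. -/
noncomputable def truncSub (a : ℝ) (X : Matrix n n ℂ) : Matrix n n ℂ :=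
  cfc (fun t => max (t - a) 0) X

theorem posSemidef_truncSub (a : ℝ) (X : Matrix n n ℂ) : (truncSub a X).PosSemidef :=
  posSemidef_cfc fun _ _ => le_max_right _ _

/-- With `S = max(D, r)⁻¹`, two comparisons combine: `Tr (E S T²) ≤ Tr (E T S T)`, and `T S T ≤ P`.
The cutoff at `r` keeps `S` defined when `D` is singular and makes `r⁻¹ - S` live under `E`. -/
theorem reTrace_upperProj_le_of_factor {D T P : Matrix n n ℂ} {r : ℝ} (hr : 0 < r)
    (hD : D.IsHermitian) (hT : T.IsHermitian) (hDT : (D - T * T).PosSemidef)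
    (hP : P.IsHermitian) (hPP : P * P = P) (hPT : P * T = T) :
    reTrace (upperProj r D * cfc (fun t => (max t r)⁻¹) D * (T * T)) ≤
      reTrace (upperProj r D * P) := by
  set E := upperProj r D with hE
  set S := cfc (fun t => (max t r)⁻¹) D with hS
  set R := cfc (fun t => r⁻¹ - (max t r)⁻¹) D with hR
  set W := cfc (fun t => √(max t r)⁻¹) D with hW
  have hpos : ∀ t, 0 < max t r := fun t => lt_max_of_lt_right hr
  have hRS : S = r⁻¹ • (1 : Matrix n n ℂ) - R := by
    rw [hR, matrix_cfc_sub, matrix_cfc_const _ hD]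
    abel
  have hER : E * R = R := by
    rw [hE, upperProj, hR, ← matrix_cfc_mul]
    refine cfc_congr fun t _ => ?_
    split_ifs with h
    · rw [one_mul]
    · rw [max_eq_right (not_lt.1 h)]; simp
  have hRpos : R.PosSemidef := posSemidef_cfc fun t _ =>
    sub_nonneg.2 (inv_anti₀ hr (le_max_right _ _))
  have hTRT : (T * R * T).PosSemidef := by
    simpa only [hT.eq] using hRpos.mul_mul_conjTranspose_same T
  -- Writing `S = r⁻¹ - R` with `E R = R`, the claim becomes `Tr (E T R T) ≤ Tr (T R T)`.
  have h1 : reTrace (E * S * (T * T)) ≤ reTrace (E * (T * S * T)) := by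
    have h := reTrace_mul_nonneg (posSemidef_one_sub_upperProj r hD) hTRT
    rw [← hE, sub_mul, one_mul, map_sub] at h
    have h2 : reTrace (T * R * T) = reTrace (R * (T * T)) := by
      rw [mul_assoc, reTrace_mul_comm, mul_assoc]
    have h3 : E * S * (T * T) = r⁻¹ • (E * (T * T)) - R * (T * T) := by
      rw [hRS, mul_sub, hER, sub_mul, mul_smul_comm, mul_one, smul_mul_assoc]
    have h4 : E * (T * S * T) = r⁻¹ • (E * (T * T)) - E * (T * R * T) := by
      rw [hRS, mul_sub, sub_mul, mul_smul_comm, mul_one, smul_mul_assoc, mul_sub, mul_smul_comm]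
    rw [h3, h4, map_sub, map_sub]
    linarith
  have hWH : W.IsHermitian := isHermitian_cfc _ _
  have hWW : W * W = S := by
    rw [hW, ← matrix_cfc_mul, hS]
    exact cfc_congr fun t _ => Real.mul_self_sqrt (inv_nonneg.2 (hpos t).le)
  have hWD : W * cfc (fun t => max t r) D * W = 1 := by
    rw [hW, ← matrix_cfc_mul, ← matrix_cfc_mul, ← one_smul ℝ (1 : Matrix n n ℂ),
      ← matrix_cfc_const 1 hD]
    refine cfc_congr fun t _ => ?_
    have := Real.mul_self_sqrt (inv_nonneg.2 (hpos t).le)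
    have h5 := (hpos t).ne'
    rw [mul_right_comm, this, inv_mul_cancel₀ h5]
  have hDmax : (cfc (fun t => max t r) D - T * T).PosSemidef := by
    have h : (cfc (fun t => max t r) D - cfc (fun t : ℝ => t) D).PosSemidef :=
      posSemidef_cfc_sub fun t _ => le_max_left _ _
    rw [matrix_cfc_id hD] at h
    simpa using h.add hDT
  -- Conjugating `T² ≤ max(D, r)` by `W = max(D, r)^(-1/2)` shows that `W T` is a contraction. Its
  -- other product is `T S T`, which is then compressed by `P`.
  have hK : (1 - (W * T) * (W * T)ᴴ).PosSemidef := by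
    have h := hDmax.mul_mul_conjTranspose_same W
    rw [hWH.eq, mul_sub, sub_mul, hWD] at h
    rw [conjTranspose_mul, hWH.eq, hT.eq]
    simpa only [mul_assoc] using h
  have hK' : (P - T * S * T).PosSemidef := by
    have h := (posSemidef_one_sub_conjTranspose_mul hK).mul_mul_conjTranspose_same P
    have hTP : T * P = T := by
      have := congrArg conjTranspose hPT
      rwa [conjTranspose_mul, hT.eq, hP.eq] at this
    have h6 : P * (1 - (W * T)ᴴ * (W * T)) * Pᴴ = P - T * S * T := by
      rw [conjTranspose_mul, hWH.eq, hT.eq, hP.eq, ← hWW, mul_sub, sub_mul, mul_one, hPP]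
      congr 1
      calc P * (T * W * (W * T)) * P = (P * T) * W * W * (T * P) := by simp only [mul_assoc]
        _ = T * (W * W) * T := by rw [hPT, hTP]; simp only [mul_assoc]
    rwa [h6] at h
  exact h1.trans (reTrace_mul_le (posSemidef_upperProj r D) hK')

theorem reTrace_upperProj_le_truncSub {A D : Matrix n n ℂ} {a r : ℝ} (hr : 0 < r)
    (hD : D.IsHermitian) (hAD : (D - truncSub a A).PosSemidef) :
    reTrace (upperProj r D * cfc (fun t => (max t r)⁻¹) D * truncSub a A) ≤
      reTrace (upperProj r D * upperProj a A) := by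
  have hT : cfc (fun t => √(max (t - a) 0)) A * cfc (fun t => √(max (t - a) 0)) A =
      truncSub a A := by
    rw [← matrix_cfc_mul]
    exact cfc_congr fun t _ => Real.mul_self_sqrt (le_max_right _ _)
  rw [← hT] at hAD ⊢
  refine reTrace_upperProj_le_of_factor hr hD (isHermitian_cfc _ _) hAD (isHermitian_cfc _ _) ?_ ?_
  · rw [upperProj, ← matrix_cfc_mul]
    exact cfc_congr fun t _ => by split_ifs <;> simp
  · rw [upperProj, ← matrix_cfc_mul]
    refine cfc_congr fun t _ => ?_
    split_ifs with h
    · rw [one_mul]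
    · rw [max_eq_right (by linarith)]; simp

theorem posSemidef_sub_truncSub {A : Matrix n n ℂ} (hA : A.PosSemidef) (a : ℝ) :
    (A - (truncSub a A + a • upperProj a A)).PosSemidef := by
  have h : (cfc (fun t : ℝ => t) A -
      cfc (fun t => max (t - a) 0 + a * (if a < t then 1 else 0)) A).PosSemidef := by
    refine posSemidef_cfc_sub fun t ht => ?_
    have := spectrum_nonneg hA ht
    split_ifs with h
    · rw [max_eq_left (by linarith)]; linarith
    · rw [max_eq_right (by linarith)]; linarith
  rwa [matrix_cfc_id hA.isHermitian, matrix_cfc_add, matrix_cfc_const_mul] at h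

/-- Let `E` be the projection attaining the excess of `D = (A - a)₊ + (B - a)₊`. Since `A ≥ (A - a)₊
+ a P_A`, and likewise for `B`, testing `A + B` against `E` gains `a Tr E (P_A + P_B)` over testing
`D`; this must be at least `a Tr E`. -/
theorem excess_truncSub_add_le_of_pos {A B : Matrix n n ℂ} (hA : A.PosSemidef)
    (hB : B.PosSemidef) {a r : ℝ} (ha : 0 ≤ a) (hr : 0 < r) :
    excess r (truncSub a A + truncSub a B) ≤ excess (a + r) (A + B) := by
  set D := truncSub a A + truncSub a B with hDdef
  have hXA := posSemidef_truncSub a A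
  have hXB := posSemidef_truncSub a B
  have hD : D.IsHermitian := (hXA.add hXB).isHermitian
  have hEpos := posSemidef_upperProj r D
  have h1 := reTrace_upperProj_le_truncSub (A := A) (a := a) hr hD
    (by rw [hDdef, add_sub_cancel_left]; exact hXB)
  have h2 := reTrace_upperProj_le_truncSub (A := B) (a := a) hr hD
    (by rw [hDdef, add_sub_cancel_right]; exact hXA)
  have h3 : upperProj r D * cfc (fun t => (max t r)⁻¹) D * D = upperProj r D := by
    nth_rewrite 3 [← matrix_cfc_id hD]
    rw [upperProj, ← matrix_cfc_mul, ← matrix_cfc_mul]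
    refine cfc_congr fun t _ => ?_
    split_ifs with h
    · rw [max_eq_left h.le, one_mul, inv_mul_cancel₀ (by linarith)]
    · simp
  -- `E max(D, r)⁻¹ D = E`; splitting the last `D` into its two summands lets the factor lemma bound
  -- each piece.
  have h4 : reTrace (upperProj r D) ≤
      reTrace (upperProj r D * upperProj a A) + reTrace (upperProj r D * upperProj a B) := by
    have h := congrArg reTrace h3
    nth_rewrite 3 [hDdef] at h
    rw [mul_add, map_add] at h
    linarith
  have h5 := reTrace_mul_le hEpos (posSemidef_sub_truncSub hA a)
  have h6 := reTrace_mul_le hEpos (posSemidef_sub_truncSub hB a)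
  rw [mul_add, map_add, mul_smul_comm, map_smul, smul_eq_mul] at h5 h6
  have h7 := reTrace_effect_le_excess (a + r) (hA.add hB).isHermitian hEpos
    (posSemidef_one_sub_upperProj r hD)
  rw [mul_add, map_add] at h7
  rw [excess_eq_reTrace r hD]
  have h8 : reTrace (upperProj r D * D) =
      reTrace (upperProj r D * truncSub a A) + reTrace (upperProj r D * truncSub a B) := by
    rw [← map_add, ← mul_add]
  nlinarith [mul_le_mul_of_nonneg_left h4 ha]

theorem excess_truncSub_add_le {A B : Matrix n n ℂ} (hA : A.PosSemidef)
    (hB : B.PosSemidef) {a r : ℝ} (ha : 0 ≤ a) (hr : 0 ≤ r) :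
    excess r (truncSub a A + truncSub a B) ≤ excess (a + r) (A + B) := by
  rcases hr.eq_or_lt with rfl | hr
  swap
  · exact excess_truncSub_add_le_of_pos hA hB ha hr
  have hD := (posSemidef_truncSub a A).add (posSemidef_truncSub a B)
  have hanti : ∀ {r s : ℝ} {X : Matrix n n ℂ}, r ≤ s → excess s X ≤ excess r X := by
    intro r s X hrs
    have := reTrace_nonneg (posSemidef_cfc_sub (X := X) (f := fun t => max (t - s) 0)
      (g := fun t => max (t - r) 0) fun t _ => max_le_max (by linarith) le_rfl)
    rw [map_sub] at this
    unfold excess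
    linarith
  have hone : reTrace (1 : Matrix n n ℂ) = Fintype.card n := by simp [reTrace_apply]
  -- The case `r = 0` is a limit: moving the threshold from `0` to `δ` costs at most `δ` times the
  -- dimension. The `+ 1` in the denominator covers dimension zero.
  refine le_of_forall_pos_le_add fun ε hε => ?_
  set c : ℝ := (Fintype.card n : ℝ)
  have hc : 0 ≤ c := Nat.cast_nonneg _
  have hδ : 0 < ε / (c + 1) := by positivity
  have h1 := excess_truncSub_add_le_of_pos hA hB ha hδ
  have h2 := reTrace_effect_le_excess (ε / (c + 1)) hD.isHermitian
    (PosSemidef.one (n := n) (R := ℂ)) (by rw [sub_self]; exact PosSemidef.zero)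
  rw [one_mul, hone] at h2
  have h3 := hanti (X := A + B) (show a + 0 ≤ a + ε / (c + 1) by linarith)
  rw [excess_of_nonpos le_rfl hD]
  have h4 : ε / (c + 1) * c ≤ ε := by
    rw [div_mul_eq_mul_div, div_le_iff₀ (by positivity)]
    nlinarith
  linarith

/-- The projection of `A + B` onto `(s, ∞)` attains the excess of `A + B` at level `a + max (s - a)
0`, while for the sum of truncations it is only a competitor at level `max (s - a) 0`. -/
theorem reTrace_upperProj_truncSub_add_le {A B : Matrix n n ℂ} (hA : A.PosSemidef)
    (hB : B.PosSemidef) {a : ℝ} (ha : 0 ≤ a) (s : ℝ) :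
    reTrace (upperProj s (A + B) * (truncSub a A + truncSub a B)) ≤
      reTrace (upperProj s (A + B) * truncSub a (A + B)) := by
  set C := A + B with hC
  have hCpos : C.PosSemidef := hA.add hB
  set r := max (s - a) 0 with hr
  have hr0 : 0 ≤ r := le_max_right _ _
  have h1 := reTrace_effect_le_excess r
    ((posSemidef_truncSub a A).add (posSemidef_truncSub a B)).isHermitian
    (posSemidef_upperProj s C) (posSemidef_one_sub_upperProj s hCpos.isHermitian)
  have h2 := excess_truncSub_add_le hA hB ha hr0
  have h3 : excess (a + r) C =
      reTrace (upperProj s C * truncSub a C) - r * reTrace (upperProj s C) := by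
    have h4 : r * reTrace (upperProj s C) = reTrace (r • upperProj s C) := by
      rw [map_smul, smul_eq_mul]
    rw [h4, ← map_sub, excess, upperProj, truncSub, ← matrix_cfc_mul,
      ← matrix_cfc_const_mul, ← matrix_cfc_sub]
    congr 1
    refine cfc_congr fun t _ => ?_
    split_ifs with h
    · rw [mul_one, one_mul]
      rcases le_total t a with hta | hta
      · rw [max_eq_right (by linarith), max_eq_right (by linarith), hr,
          max_eq_right (by linarith)]; ring
      · have : r ≤ t - a := max_le (by linarith) (by linarith)
        rw [max_eq_left (by linarith), max_eq_left (by linarith)]; ring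
    · have : s - a ≤ r := le_max_left _ _
      rw [max_eq_right (by linarith)]; ring
  linarith

end Subadditivity

/-! ### Concave functions on finite sets and half-lines. -/

section ConcaveDecomposition

/-- A nondecreasing, discretely concave function on a finite set of nonnegative reals containing
`0` is, up to the constant `f 0`, a nonnegative combination of truncations `t ↦ min t a`. -/
theorem exists_eq_sum_mul_min (T : Finset ℝ) :
    ∀ f : ℝ → ℝ, (∀ t ∈ T, 0 < t) →
      (∀ x ∈ insert 0 T, ∀ y ∈ insert 0 T, x ≤ y → f x ≤ f y) →
      (∀ x ∈ insert 0 T, ∀ y ∈ insert 0 T, ∀ z ∈ insert 0 T, x < y → y < z →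
        (f z - f y) * (y - x) ≤ (f y - f x) * (z - y)) →
      ∃ c : ℝ → ℝ, (∀ a, 0 ≤ c a) ∧ ∀ t ∈ insert 0 T, f t = f 0 + ∑ a ∈ T, c a * min t a := by
  induction T using Finset.induction_on_max with
  | empty => exact fun f _ _ _ => ⟨0, fun _ => le_rfl, by simp⟩
  | insert M T hM ih =>
    intro f hpos hmono hconc
    have hMpos : 0 < M := hpos M (Finset.mem_insert_self _ _)
    have hlt : ∀ x ∈ insert 0 T, x < M := by
      intro x hx
      rcases Finset.mem_insert.1 hx with rfl | hx
      exacts [hMpos, hM x hx]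
    have hsub : ∀ x ∈ insert 0 T, x ∈ insert 0 (insert M T) := by
      intro x hx
      rcases Finset.mem_insert.1 hx with rfl | hx <;> simp [*]
    have hMmem : M ∈ insert 0 (insert M T) := by simp
    obtain ⟨b, hbT, hb⟩ := Finset.exists_max_image (insert 0 T) id ⟨0, by simp⟩
    simp only [id] at hb
    have hbM := hlt b hbT
    -- The slope of the last segment is the smallest, so `f t - k t` is still nondecreasing and
    -- concave on the remaining points. The subtracted `k t` is restored as `k * min t M`.
    set k := (f M - f b) / (M - b) with hk
    have hk0 : 0 ≤ k := div_nonneg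
      (sub_nonneg.2 (hmono b (hsub b hbT) M hMmem hbM.le)) (by linarith)
    have hkb : k * (M - b) = f M - f b := div_mul_cancel₀ _ (by linarith)
    have hslope : ∀ y ∈ insert 0 T, k * (M - y) ≤ f M - f y := by
      intro y hy
      rcases (hb y hy).eq_or_lt with rfl | hyb
      · exact hkb.le
      · have h := hconc y (hsub y hy) b (hsub b hbT) M hMmem hyb hbM
        rw [← hkb] at h
        have h' : k * (b - y) ≤ f b - f y := by
          refine le_of_mul_le_mul_right ?_ (sub_pos.2 hbM)
          linarith
        linarith
    obtain ⟨c, hc0, hc⟩ := ih (fun t => f t - k * t) (fun t ht => hpos t (by simp [ht])) (by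
        intro x hx y hy hxy
        rcases hxy.eq_or_lt with rfl | hxy
        · exact le_rfl
        have h := hconc x (hsub x hx) y (hsub y hy) M hMmem hxy (hlt y hy)
        have h2 := mul_le_mul_of_nonneg_right (hslope y hy) (sub_pos.2 hxy).le
        have h3 : k * (y - x) ≤ f y - f x := by
          refine le_of_mul_le_mul_right ?_ (sub_pos.2 (hlt y hy))
          linarith
        linarith) (by
        intro x hx y hy z hz hxy hyz
        have h := hconc x (hsub x hx) y (hsub y hy) z (hsub z hz) hxy hyz
        linarith)
    have hMT : M ∉ T := fun h => (hM M h).false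
    refine ⟨Function.update c M k, fun a => ?_, fun t ht => ?_⟩
    · rcases eq_or_ne a M with rfl | h
      · simpa using hk0
      · simpa [h] using hc0 a
    have hsum : ∀ t, ∑ a ∈ insert M T, Function.update c M k a * min t a =
        k * min t M + ∑ a ∈ T, c a * min t a := by
      intro t
      rw [Finset.sum_insert hMT, Function.update_self]
      congr 1
      refine Finset.sum_congr rfl fun a ha => ?_
      rw [Function.update_of_ne (by rintro rfl; exact hMT ha)]
    rw [hsum]
    have hold : ∀ t ∈ insert 0 T, f t = f 0 + (k * min t M + ∑ a ∈ T, c a * min t a) := by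
      intro t ht
      have := hc t ht
      rw [min_eq_left (hlt t ht).le]
      linarith
    rcases Finset.mem_insert.1 ht with rfl | ht'
    · exact hold 0 (by simp)
    rcases Finset.mem_insert.1 ht' with rfl | ht'
    -- At the top point every `min t a` with `a ∈ T` has the same value as at `b`, so the whole
    -- increment from `b` comes from the new term.
    · have h1 := hold b hbT
      have h2 : ∑ a ∈ T, c a * min t a = ∑ a ∈ T, c a * min b a := by
        refine Finset.sum_congr rfl fun a ha => ?_
        rw [min_eq_right (hM a ha).le, min_eq_right (hb a (by simp [ha]))]
      rw [h2, min_self]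
      rw [min_eq_left hbM.le] at h1
      linarith
    · exact hold t (by simp [ht'])

theorem ConcaveOn.monotoneOn_of_nonneg {f : ℝ → ℝ} (hf : ConcaveOn ℝ (Set.Ici (0 : ℝ)) f)
    (hf0 : ∀ t ∈ Set.Ici (0 : ℝ), 0 ≤ f t) : MonotoneOn f (Set.Ici 0) := by
  intro x hx y hy hxy
  rcases hxy.eq_or_lt with rfl | hxy
  · exact le_rfl
  by_contra! hlt
  have hx0 : 0 ≤ x := hx
  -- The point where the line through the graph at `x` and `y` reaches height `-1`; concavity puts
  -- `f z` below it.
  set z := y + (f y + 1) * (y - x) / (f x - f y) with hz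
  have hd : 0 < f x - f y := by linarith
  have hfy := hf0 y hy
  have hyx : 0 < y - x := by linarith
  have hyz : y < z := by
    have : 0 < (f y + 1) * (y - x) / (f x - f y) := by positivity
    linarith
  have hzmem : z ∈ Set.Ici (0 : ℝ) := by
    show 0 ≤ z
    linarith
  have h := hf.slope_anti_adjacent hx hzmem hxy hyz
  rw [div_le_div_iff₀ (by linarith) hyx] at h
  have hzy : (z - y) * (f x - f y) = (f y + 1) * (y - x) := by
    rw [hz, add_sub_cancel_left, div_mul_cancel₀ _ hd.ne']
  have := mul_nonneg (hf0 z hzmem) hyx.le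
  nlinarith

end ConcaveDecomposition

/-! ### Subadditivity for concave functions of positive matrices. -/

section ConcaveSubadditivity

variable {n : Type*} [Fintype n] [DecidableEq n]

theorem reTrace_upperProj_cfc_min_le {A B : Matrix n n ℂ} (hA : A.PosSemidef)
    (hB : B.PosSemidef) {a : ℝ} (ha : 0 ≤ a) (s : ℝ) :
    reTrace (upperProj s (A + B) * cfc (fun t => min t a) (A + B)) ≤
      reTrace (upperProj s (A + B) * (cfc (fun t => min t a) A + cfc (fun t => min t a) B)) := by
  have hmin : ∀ {X : Matrix n n ℂ}, X.IsHermitian →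
      cfc (fun t => min t a) X = X - truncSub a X := by
    intro X hX
    nth_rewrite 2 [← matrix_cfc_id hX]
    rw [truncSub, ← matrix_cfc_sub]
    refine cfc_congr fun t _ => ?_
    rcases le_total t a with h | h
    · simp [h]
    · simp [h]
  rw [hmin hA.isHermitian, hmin hB.isHermitian, hmin (hA.add hB).isHermitian]
  have h := reTrace_upperProj_truncSub_add_le hA hB ha s
  have h2 : A - truncSub a A + (B - truncSub a B) =
      (A + B) - (truncSub a A + truncSub a B) := by abel
  rw [h2, mul_sub, mul_sub _ (A + B), map_sub, map_sub]
  linarith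

/-- Only the values of `f` on the three finite spectra matter, and there `f` is a nonnegative
combination of `min t a`. The projection does not depend on `a`, so the inequalities for the
individual `a` add up. -/
theorem reTrace_upperProj_cfc_concave_le {A B : Matrix n n ℂ} (hA : A.PosSemidef)
    (hB : B.PosSemidef) {f : ℝ → ℝ} (hf_nonneg : ∀ t ∈ Set.Ici (0 : ℝ), 0 ≤ f t)
    (hf : ConcaveOn ℝ (Set.Ici (0 : ℝ)) f) (hf0 : f 0 = 0) (s : ℝ) :
    reTrace (upperProj s (A + B) * cfc f (A + B)) ≤
      reTrace (upperProj s (A + B) * (cfc f A + cfc f B)) := by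
  have hfin : (spectrum ℝ A ∪ spectrum ℝ B ∪ spectrum ℝ (A + B)).Finite :=
    (A.finite_real_spectrum.union B.finite_real_spectrum).union (A + B).finite_real_spectrum
  set T := hfin.toFinset.filter (0 < ·) with hT
  have hT0 : ∀ t ∈ insert 0 T, t ∈ Set.Ici (0 : ℝ) := by
    intro t ht
    rcases Finset.mem_insert.1 ht with rfl | ht
    · exact Set.self_mem_Ici
    · exact (Finset.mem_filter.1 ht).2.le
  obtain ⟨c, hc0, hc⟩ := exists_eq_sum_mul_min T f (fun t ht => (Finset.mem_filter.1 ht).2)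
    (fun x hx y hy hxy => hf.monotoneOn_of_nonneg hf_nonneg (hT0 x hx) (hT0 y hy) hxy)
    (fun x hx y hy z hz hxy hyz => by
      have h := hf.slope_anti_adjacent (hT0 x hx) (hT0 z hz) hxy hyz
      rwa [div_le_div_iff₀ (by linarith) (by linarith)] at h)
  have hmem : ∀ {X : Matrix n n ℂ}, X.PosSemidef →
      spectrum ℝ X ⊆ spectrum ℝ A ∪ spectrum ℝ B ∪ spectrum ℝ (A + B) →
      cfc f X = ∑ a ∈ T, c a • cfc (fun t => min t a) X := by
    intro X hX hsub
    have h1 : cfc f X = cfc (fun t => ∑ a ∈ T, c a * min t a) X := by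
      refine cfc_congr fun t ht => ?_
      have h := hc t (by
        rcases (spectrum_nonneg hX ht).eq_or_lt with h | h
        · simp [← h]
        · exact Finset.mem_insert_of_mem (Finset.mem_filter.2 ⟨hfin.mem_toFinset.2 (hsub ht), h⟩))
      rw [h, hf0, zero_add]
    have h2 := cfc_sum (fun a t => c a * min t a) X T fun a _ => continuousOn_spectrum _ X
    rw [h1, ← Finset.sum_fn, h2]
    exact Finset.sum_congr rfl fun a _ => matrix_cfc_const_mul _ _ X
  rw [hmem hA (by intro t ht; simp [ht]), hmem hB (by intro t ht; simp [ht]),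
    hmem (hA.add hB) (by intro t ht; simp [ht]), ← Finset.sum_add_distrib, Finset.mul_sum,
    Finset.mul_sum, map_sum, map_sum]
  refine Finset.sum_le_sum fun a ha => ?_
  rw [← smul_add, mul_smul_comm, mul_smul_comm, map_smul, map_smul]
  exact mul_le_mul_of_nonneg_left
    (reTrace_upperProj_cfc_min_le hA hB (hT0 a (Finset.mem_insert_of_mem ha)) s) (hc0 a)

/-- Used to recognize a spectral projection of `f (A + B)` as one of `A + B`; monotonicity makes
each superlevel set an upper part of the spectrum. -/
theorem exists_lt_iff_lt_of_monotoneOn {S : Set ℝ} (hS : S.Finite) {f : ℝ → ℝ}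
    (hf : MonotoneOn f S) (r : ℝ) : ∃ s, ∀ t ∈ S, r < f t ↔ s < t := by
  have hfin : (S ∩ {t | f t ≤ r}).Finite := hS.subset Set.inter_subset_left
  rcases (S ∩ {t | f t ≤ r}).eq_empty_or_nonempty with h | h
  · obtain ⟨s, hs⟩ := hS.bddBelow
    refine ⟨s - 1, fun t ht => ⟨fun _ => by linarith [hs ht], fun _ => ?_⟩⟩
    by_contra! hlt
    exact (h ▸ (⟨ht, hlt⟩ : t ∈ S ∩ {t | f t ≤ r}) : t ∈ (∅ : Set ℝ))
  · obtain ⟨s, hs, hmax⟩ := hfin.exists_maximal h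
    refine ⟨s, fun t ht => ⟨fun hlt => ?_, fun hlt => ?_⟩⟩
    · by_contra! hts
      exact absurd (hf ht hs.1 hts) (not_le.2 (hs.2.trans_lt hlt))
    · by_contra! hle
      exact absurd (hmax ⟨ht, hle⟩ hlt.le) (not_le.2 hlt)

theorem excess_cfc_add_le {A B : Matrix n n ℂ} (hA : A.PosSemidef)
    (hB : B.PosSemidef) {f : ℝ → ℝ} (hf_nonneg : ∀ t ∈ Set.Ici (0 : ℝ), 0 ≤ f t)
    (hf : ConcaveOn ℝ (Set.Ici (0 : ℝ)) f) (hf0 : f 0 = 0) (r : ℝ) :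
    excess r (cfc f (A + B)) ≤ excess r (cfc f A + cfc f B) := by
  have hC : (A + B).PosSemidef := hA.add hB
  obtain ⟨s, hs⟩ := exists_lt_iff_lt_of_monotoneOn (A + B).finite_real_spectrum
    ((hf.monotoneOn_of_nonneg hf_nonneg).mono fun t ht => spectrum_nonneg hC ht) r
  have h1 : upperProj r (cfc f (A + B)) = upperProj s (A + B) := by
    rw [upperProj, ← matrix_cfc_comp _ f hC.isHermitian]
    exact cfc_congr fun t ht => by simp only [hs t ht]
  rw [excess_eq_reTrace r (isHermitian_cfc _ _), h1]
  have h2 := reTrace_upperProj_cfc_concave_le hA hB hf_nonneg hf hf0 s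
  have h3 := reTrace_effect_le_excess r
    ((isHermitian_cfc f A).add (isHermitian_cfc f B)) (posSemidef_upperProj s (A + B))
    (posSemidef_one_sub_upperProj s hC.isHermitian)
  linarith

end ConcaveSubadditivity

/-! ### Traces as eigenvalue sums, and Weyl monotonicity. -/

section SpectralTrace

variable {m n : Type*} [Fintype m] [DecidableEq m] [Fintype n] [DecidableEq n]

theorem reTrace_cfc_eq_sum {X : Matrix n n ℂ} (hX : X.IsHermitian) (φ : ℝ → ℝ) :
    reTrace (cfc φ X) = ∑ i, φ (hX.eigenvalues i) := by
  rw [hX.cfc_eq, IsHermitian.cfc, Unitary.conjStarAlgAut_apply, reTrace_mul_comm, ← mul_assoc,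
    Unitary.coe_star_mul_self, one_mul, reTrace_apply, trace_diagonal]
  simp

theorem reTrace_cfc_eq_sum_roots {X : Matrix n n ℂ} (hX : X.IsHermitian) (φ : ℝ → ℝ) :
    reTrace (cfc φ X) = (X.charpoly.roots.map fun z => φ z.re).sum := by
  rw [reTrace_cfc_eq_sum hX, hX.roots_charpoly_eq_eigenvalues, Multiset.map_map]
  exact Finset.sum_congr rfl fun i _ => by simp

theorem reTrace_cfc_eq_sum_sorted {X : Matrix n n ℂ} (hX : X.IsHermitian) (φ : ℝ → ℝ) :
    reTrace (cfc φ X) = ∑ i, φ (hX.eigenvalues₀ i) := by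
  rw [reTrace_cfc_eq_sum_roots hX, hX.roots_charpoly_eq_eigenvalues₀, Multiset.map_map]
  exact Finset.sum_congr rfl fun i _ => by simp

/-- The characteristic polynomials agree up to powers of `X`, and the extra zero roots contribute `φ
0 = 0`. -/
theorem reTrace_cfc_conjTranspose_mul_comm (M : Matrix m n ℂ) {φ : ℝ → ℝ} (hφ : φ 0 = 0) :
    reTrace (cfc φ (Mᴴ * M)) = reTrace (cfc φ (M * Mᴴ)) := by
  have h := congrArg Polynomial.roots (charpoly_mul_comm' M Mᴴ)
  rw [Polynomial.roots_mul (mul_ne_zero (pow_ne_zero _ Polynomial.X_ne_zero)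
      (charpoly_monic _).ne_zero),
    Polynomial.roots_mul (mul_ne_zero (pow_ne_zero _ Polynomial.X_ne_zero)
      (charpoly_monic _).ne_zero), Polynomial.roots_X_pow, Polynomial.roots_X_pow] at h
  have h2 := congrArg (fun s : Multiset ℂ => (s.map fun z => φ z.re).sum) h
  simp only [Multiset.map_add, Multiset.sum_add, Multiset.map_nsmul, Multiset.sum_nsmul,
    Multiset.map_singleton, Multiset.sum_singleton, Complex.zero_re, hφ, smul_zero,
    zero_add] at h2
  rw [reTrace_cfc_eq_sum_roots (isHermitian_conjTranspose_mul_self M),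
    reTrace_cfc_eq_sum_roots (isHermitian_mul_conjTranspose_self M), h2]

theorem reTrace_cfc_fromBlocks {P : Matrix m m ℂ} {Q : Matrix n n ℂ} (hP : P.IsHermitian)
    (hQ : Q.IsHermitian) (φ : ℝ → ℝ) :
    reTrace (cfc φ (fromBlocks P 0 0 Q)) = reTrace (cfc φ P) + reTrace (cfc φ Q) := by
  have hPQ : (fromBlocks P 0 0 Q).IsHermitian := by
    rw [IsHermitian, fromBlocks_conjTranspose, hP.eq, hQ.eq, conjTranspose_zero,
      conjTranspose_zero]
  rw [reTrace_cfc_eq_sum_roots hPQ, reTrace_cfc_eq_sum_roots hP, reTrace_cfc_eq_sum_roots hQ,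
    charpoly_fromBlocks_zero₁₂, Polynomial.roots_mul (mul_ne_zero (charpoly_monic _).ne_zero
      (charpoly_monic _).ne_zero), Multiset.map_add, Multiset.sum_add]

theorem rank_cfc {X : Matrix n n ℂ} (hX : X.IsHermitian) (φ : ℝ → ℝ) :
    (cfc φ X).rank = Fintype.card {i // φ (hX.eigenvalues i) ≠ 0} := by
  rw [hX.cfc_eq, IsHermitian.cfc, Unitary.conjStarAlgAut_apply, ← Unitary.coe_star]
  simp [-isUnit_iff_ne_zero, -Unitary.coe_star, rank_diagonal]

/-- A nonzero vector in the range of `E` has `⟨Kw, w⟩ > s‖w‖²`, one in the kernel of `F` has `⟨Cw,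
w⟩ ≤ s‖w‖²`. As `K ≤ C`, `F` is injective on the range of `E`. -/
theorem rank_upperProj_le {K C : Matrix n n ℂ} (hK : K.IsHermitian) (hC : C.IsHermitian)
    (h : (C - K).PosSemidef) (s : ℝ) : (upperProj s K).rank ≤ (upperProj s C).rank := by
  set E := upperProj s K with hE
  set F := upperProj s C with hF
  suffices hker : ∀ v, (F * E) *ᵥ v = 0 → E *ᵥ v = 0 by
    have h1 : E.rank ≤ (F * E).rank := by
      have hle : LinearMap.ker (F * E).mulVecLin ≤ LinearMap.ker E.mulVecLin := by
        intro v hv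
        simp only [LinearMap.mem_ker, mulVecLin_apply] at hv ⊢
        exact hker v hv
      have h2 := Submodule.finrank_mono hle
      have h3 := LinearMap.finrank_range_add_finrank_ker (F * E).mulVecLin
      have h4 := LinearMap.finrank_range_add_finrank_ker E.mulVecLin
      unfold Matrix.rank
      omega
    exact h1.trans (rank_mul_le_left F E)
  intro v hv
  have hEE : E * E = E := by
    rw [hE, upperProj, ← matrix_cfc_mul]
    exact cfc_congr fun t _ => by split_ifs <;> simp
  set w := E *ᵥ v with hw
  have hEw : E *ᵥ w = w := by rw [hw, mulVec_mulVec, hEE]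
  have hFw : F *ᵥ w = 0 := by rw [hw, mulVec_mulVec, hv]
  set P := truncSub s K with hP
  set Q := cfc (fun t => max (s - t) 0) C with hQ
  have hPpos : P.PosSemidef := posSemidef_truncSub s K
  have hQpos : Q.PosSemidef := posSemidef_cfc fun _ _ => le_max_right _ _
  have hKw : P *ᵥ w = K *ᵥ w - s • w := by
    have h1 : P = (K - s • (1 : Matrix n n ℂ)) * E := by
      have h2 : K - s • (1 : Matrix n n ℂ) = cfc (fun t => t - s) K := by
        rw [matrix_cfc_sub, matrix_cfc_id hK, matrix_cfc_const s hK]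
      rw [h2, hE, upperProj, ← matrix_cfc_mul]
      refine cfc_congr fun t _ => ?_
      split_ifs with h
      · rw [max_eq_left (by linarith), mul_one]
      · rw [max_eq_right (by linarith), mul_zero]
    rw [h1, ← mulVec_mulVec, hEw, sub_mulVec, smul_mulVec, one_mulVec]
  have hCw : Q *ᵥ w = s • w - C *ᵥ w := by
    have h1 : Q = (s • (1 : Matrix n n ℂ) - C) * (1 - F) := by
      have h2 : s • (1 : Matrix n n ℂ) - C = cfc (fun t => s - t) C := by
        rw [matrix_cfc_sub, matrix_cfc_id hC, matrix_cfc_const s hC]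
      have h3 : 1 - F = cfc (fun t => 1 - if s < t then 1 else 0) C := by
        rw [matrix_cfc_sub, matrix_cfc_const 1 hC, one_smul]
        rfl
      rw [h2, h3, ← matrix_cfc_mul]
      refine cfc_congr fun t _ => ?_
      split_ifs with h
      · rw [max_eq_right (by linarith), sub_self, mul_zero]
      · rw [max_eq_left (by linarith), sub_zero, mul_one]
    rw [h1, ← mulVec_mulVec, sub_mulVec 1 F, hFw, one_mulVec, sub_zero, sub_mulVec, smul_mulVec,
      one_mulVec]
  -- On `w`, `P` acts as `K - s` and `Q` as `s - C`, so three nonnegative quadratic forms sum to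
  -- zero and each vanishes.
  have hsum : star w ⬝ᵥ P *ᵥ w + star w ⬝ᵥ Q *ᵥ w + star w ⬝ᵥ (C - K) *ᵥ w = 0 := by
    rw [← dotProduct_add, ← dotProduct_add, hKw, hCw, sub_mulVec]
    rw [show K *ᵥ w - s • w + (s • w - C *ᵥ w) + (C *ᵥ w - K *ᵥ w) = 0 by abel, dotProduct_zero]
  have hPw : P *ᵥ w = 0 := by
    rw [← hPpos.dotProduct_mulVec_zero_iff]
    refine le_antisymm ?_ (hPpos.dotProduct_mulVec_nonneg w)
    rw [← hsum, add_assoc]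
    exact le_add_of_nonneg_right
      (add_nonneg (hQpos.dotProduct_mulVec_nonneg w) (h.dotProduct_mulVec_nonneg w))
  have hEP : E = cfc (fun t => (t - s)⁻¹) K * P := by
    rw [hP, truncSub, ← matrix_cfc_mul, hE]
    refine cfc_congr fun t _ => ?_
    split_ifs with h
    · rw [max_eq_left (by linarith), inv_mul_cancel₀ (by linarith)]
    · rw [max_eq_right (by linarith), mul_zero]
  rw [← hEw, hEP, ← mulVec_mulVec, hPw, mulVec_zero]

theorem card_lt_eigenvalues₀ {X : Matrix n n ℂ} (hX : X.IsHermitian) (s : ℝ) :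
    (Finset.univ.filter fun i => s < hX.eigenvalues₀ i).card = (upperProj s X).rank := by
  rw [upperProj, rank_cfc hX, Fintype.card_subtype]
  refine Finset.card_bij'
    (fun i _ => Fintype.equivOfCardEq (Fintype.card_fin _) i)
    (fun i _ => (Fintype.equivOfCardEq (Fintype.card_fin _)).symm i) ?_ ?_
    (fun _ _ => Equiv.symm_apply_apply _ _) (fun _ _ => Equiv.apply_symm_apply _ _)
  · intro i hi
    rw [Finset.mem_filter] at hi ⊢
    simpa [IsHermitian.eigenvalues] using hi.2
  · intro i hi
    rw [Finset.mem_filter] at hi ⊢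
    exact ⟨Finset.mem_univ _, by_contra fun h => hi.2 (if_neg h)⟩

/-- Weyl's monotonicity principle for the sorted eigenvalues of Hermitian matrices. -/
theorem eigenvalues₀_mono {K C : Matrix n n ℂ} (hK : K.IsHermitian) (hC : C.IsHermitian)
    (h : (C - K).PosSemidef) (i : Fin (Fintype.card n)) :
    hK.eigenvalues₀ i ≤ hC.eigenvalues₀ i := by
  by_contra! hlt
  have h1 := rank_upperProj_le hK hC h (hC.eigenvalues₀ i)
  rw [← card_lt_eigenvalues₀ hK, ← card_lt_eigenvalues₀ hC] at h1
  -- Indices start at zero: `K` would have at least `i + 1` eigenvalues above the `i`-th one of `C`,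
  -- while `C` has at most `i`.
  have h2 : (Finset.Iic i).card ≤
      (Finset.univ.filter fun j => hC.eigenvalues₀ i < hK.eigenvalues₀ j).card := by
    refine Finset.card_le_card fun j hj => ?_
    simpa using hlt.trans_le (hK.eigenvalues₀_antitone (Finset.mem_Iic.1 hj))
  have h3 : (Finset.univ.filter fun j => hC.eigenvalues₀ i < hC.eigenvalues₀ j).card ≤
      (Finset.Iio i).card := by
    refine Finset.card_le_card fun j hj => Finset.mem_Iio.2 ?_
    by_contra! hij
    exact absurd (hC.eigenvalues₀_antitone hij) (not_le.2 (Finset.mem_filter.1 hj).2)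
  rw [Fin.card_Iic] at h2
  rw [Fin.card_Iio] at h3
  omega

theorem reTrace_cfc_mono {K C : Matrix n n ℂ} (hK : K.IsHermitian) (hC : C.IsHermitian)
    (h : (C - K).PosSemidef) {φ : ℝ → ℝ} (hφ : Monotone φ) :
    reTrace (cfc φ K) ≤ reTrace (cfc φ C) := by
  rw [reTrace_cfc_eq_sum_sorted hK, reTrace_cfc_eq_sum_sorted hC]
  exact Finset.sum_le_sum fun i _ => hφ (eigenvalues₀_mono hK hC h i)

end SpectralTrace

/-! ### Positive block matrices and the Hermitian dilation. -/

section Dilation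

variable {m n : Type*} [Fintype m] [DecidableEq m] [Fintype n] [DecidableEq n]

theorem cfc_real_sqrt_conjTranspose_mul_self (A : Matrix n n ℂ) :
    cfc Real.sqrt (Aᴴ * A) = CFC.abs A := by
  have hA : (Aᴴ * A).PosSemidef := posSemidef_conjTranspose_mul_self A
  symm
  refine CFC.sqrt_unique ?_ (posSemidef_cfc fun t _ => Real.sqrt_nonneg t).nonneg
  rw [← matrix_cfc_mul, star_eq_conjTranspose]
  nth_rewrite 2 [← matrix_cfc_id hA.isHermitian]
  exact cfc_congr fun t ht => Real.mul_self_sqrt (spectrum_nonneg hA ht)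

theorem cfc_abs_eq (f : ℝ → ℝ) (A : Matrix n n ℂ) :
    cfc f (CFC.abs A) = cfc (fun t => f √t) (Aᴴ * A) := by
  rw [← cfc_real_sqrt_conjTranspose_mul_self,
    ← matrix_cfc_comp f _ (isHermitian_conjTranspose_mul_self A)]

theorem cfc_comp_abs_eq (f : ℝ → ℝ) {H : Matrix n n ℂ} (hH : H.IsHermitian) :
    cfc (fun t => f |t|) H = cfc (fun t => f √t) (H * H) := by
  have h : H * H = cfc (fun t : ℝ => t * t) H := by rw [matrix_cfc_mul, matrix_cfc_id hH]
  rw [h, ← matrix_cfc_comp (fun t => f √t) _ hH]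
  simp only [Real.sqrt_mul_self_eq_abs]

theorem cfc_neg_eq (f : ℝ → ℝ) {H : Matrix n n ℂ} (hH : H.IsHermitian) :
    cfc f (-H) = cfc (fun t => f (-t)) H := by
  have h : -H = cfc (fun t : ℝ => -t) H := by rw [cfc_neg, matrix_cfc_id hH]
  rw [h, ← matrix_cfc_comp f _ hH]

theorem excess_smul (r c : ℝ) {X : Matrix n n ℂ} (hX : X.IsHermitian) :
    excess r (c • X) = reTrace (cfc (fun t => max (c * t - r) 0) X) := by
  have h : c • X = cfc (fun t : ℝ => c * t) X := by rw [matrix_cfc_const_mul, matrix_cfc_id hX]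
  rw [h, excess, ← matrix_cfc_comp (fun t => max (t - r) 0) _ hX]

/-- The left matrix is the average of `2 M₁ M₁ᴴ` and `2 M₂ M₂ᴴ`, each with the nonzero spectrum of
`Z`; the excess is convex. For `r ≥ 0` the zero eigenvalues do not count. -/
theorem excess_add_mul_conjTranspose_le {M₁ M₂ : Matrix m n ℂ} {Z : Matrix n n ℂ}
    (h₁ : (2 : ℝ) • (M₁ᴴ * M₁) = Z) (h₂ : (2 : ℝ) • (M₂ᴴ * M₂) = Z) {r : ℝ} (hr : 0 ≤ r) :
    excess r (M₁ * M₁ᴴ + M₂ * M₂ᴴ) ≤ excess r Z := by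
  have key : ∀ {M : Matrix m n ℂ}, (2 : ℝ) • (Mᴴ * M) = Z → ∀ {E : Matrix m m ℂ},
      E.PosSemidef → (1 - E).PosSemidef →
      reTrace (E * (M * Mᴴ)) - r / 2 * reTrace E ≤ excess r Z / 2 := by
    intro M hM E hE hE'
    have h1 := reTrace_effect_le_excess r
      ((isHermitian_mul_conjTranspose_self M).smul (IsSelfAdjoint.all (2 : ℝ))) hE hE'
    rw [excess_smul r 2 (isHermitian_mul_conjTranspose_self M),
      ← reTrace_cfc_conjTranspose_mul_comm M (by simpa using hr),
      ← excess_smul r 2 (isHermitian_conjTranspose_mul_self M), hM, mul_smul_comm, map_smul,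
      smul_eq_mul] at h1
    linarith
  have hX : (M₁ * M₁ᴴ + M₂ * M₂ᴴ).IsHermitian :=
    (isHermitian_mul_conjTranspose_self M₁).add (isHermitian_mul_conjTranspose_self M₂)
  have hE := posSemidef_upperProj r (M₁ * M₁ᴴ + M₂ * M₂ᴴ)
  have hE' := posSemidef_one_sub_upperProj r hX
  rw [excess_eq_reTrace r hX, mul_add, map_add]
  linarith [key h₁ hE hE', key h₂ hE hE']

/-- A positive semidefinite block matrix is weakly majorized by the sum of its diagonal blocks,
when these are equal. -/
theorem excess_le_of_toBlocks {X : Matrix (n ⊕ n) (n ⊕ n) ℂ} (hX : X.PosSemidef)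
    {Z : Matrix n n ℂ} (h₁ : (2 : ℝ) • X.toBlocks₁₁ = Z) (h₂ : (2 : ℝ) • X.toBlocks₂₂ = Z)
    {r : ℝ} (hr : 0 ≤ r) : excess r X ≤ excess r Z := by
  set S := cfc Real.sqrt X with hS
  have hSH : Sᴴ = S := (isHermitian_cfc _ _).eq
  have hSS : S * S = X := by
    rw [hS, ← matrix_cfc_mul]
    nth_rewrite 2 [← matrix_cfc_id hX.isHermitian]
    exact cfc_congr fun t ht => Real.mul_self_sqrt (spectrum_nonneg hX ht)
  -- With `J₁`, `J₂` the coordinate inclusions and `Mᵢ = √X Jᵢ`, the products `Mᵢᴴ Mᵢ` are the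
  -- diagonal blocks, while `M₁ M₁ᴴ + M₂ M₂ᴴ = X`.
  set J₁ : Matrix (n ⊕ n) n ℂ := fromRows 1 0
  set J₂ : Matrix (n ⊕ n) n ℂ := fromRows 0 1
  have hJ : J₁ * J₁ᴴ + J₂ * J₂ᴴ = 1 := by
    ext (i | i) (j | j) <;>
      simp [J₁, J₂, conjTranspose_fromRows_eq_fromCols_conjTranspose, one_apply]
  have hX' : S * J₁ * (S * J₁)ᴴ + S * J₂ * (S * J₂)ᴴ = X := by
    calc _ = S * (J₁ * J₁ᴴ + J₂ * J₂ᴴ) * S := by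
          simp only [conjTranspose_mul, hSH, mul_add, add_mul, Matrix.mul_assoc]
      _ = X := by rw [hJ, mul_one, hSS]
  have hblock : ∀ J : Matrix (n ⊕ n) n ℂ, (S * J)ᴴ * (S * J) = Jᴴ * X * J := by
    intro J
    rw [conjTranspose_mul, hSH, ← hSS]
    simp only [Matrix.mul_assoc]
  have hJ₁ : J₁ᴴ * X * J₁ = X.toBlocks₁₁ := by
    rw [← fromBlocks_toBlocks X]
    simp [J₁, conjTranspose_fromRows_eq_fromCols_conjTranspose, fromCols_mul_fromBlocks,
      fromCols_mul_fromRows]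
  have hJ₂ : J₂ᴴ * X * J₂ = X.toBlocks₂₂ := by
    rw [← fromBlocks_toBlocks X]
    simp [J₂, conjTranspose_fromRows_eq_fromCols_conjTranspose, fromCols_mul_fromBlocks,
      fromCols_mul_fromRows]
  rw [← hX']
  exact excess_add_mul_conjTranspose_le (by rw [hblock, hJ₁, h₁]) (by rw [hblock, hJ₂, h₂]) hr

/-- The star algebra homomorphism `P ↦ P ⊕ P`. -/
def blockDiagHom (n : Type*) [Fintype n] [DecidableEq n] :
    Matrix n n ℂ →⋆ₐ[ℝ] Matrix (n ⊕ n) (n ⊕ n) ℂ where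
  toFun P := fromBlocks P 0 0 P
  map_one' := fromBlocks_one
  map_mul' P Q := by simp [fromBlocks_multiply]
  map_zero' := fromBlocks_zero
  map_add' P Q := by simp [fromBlocks_add]
  commutes' c := by
    rw [Algebra.algebraMap_eq_smul_one, Algebra.algebraMap_eq_smul_one, ← fromBlocks_one,
      fromBlocks_smul, smul_zero]
  map_star' P := by simp [star_eq_conjTranspose, fromBlocks_conjTranspose]

theorem cfc_fromBlocks_self (f : ℝ → ℝ) {P : Matrix n n ℂ} (hP : P.IsHermitian) :
    cfc f (fromBlocks P 0 0 P) = fromBlocks (cfc f P) 0 0 (cfc f P) := by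
  have hcont : Continuous (blockDiagHom n) :=
    continuous_id.matrix_fromBlocks continuous_const continuous_const continuous_id
  exact ((blockDiagHom n).map_cfc f P (continuousOn_spectrum f P) hcont hP.isSelfAdjoint
    (hP.isSelfAdjoint.map (blockDiagHom n))).symm

/-- The Hermitian dilation of a square matrix. -/
def hermDilation (A : Matrix n n ℂ) : Matrix (n ⊕ n) (n ⊕ n) ℂ := fromBlocks 0 A Aᴴ 0

theorem isHermitian_hermDilation (A : Matrix n n ℂ) : (hermDilation A).IsHermitian := by
  simp [hermDilation, IsHermitian, fromBlocks_conjTranspose]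

theorem hermDilation_add (A B : Matrix n n ℂ) :
    hermDilation (A + B) = hermDilation A + hermDilation B := by
  simp [hermDilation, fromBlocks_add]

theorem hermDilation_mul_self (A : Matrix n n ℂ) :
    hermDilation A * hermDilation A = fromBlocks (A * Aᴴ) 0 0 (Aᴴ * A) := by
  simp [hermDilation, fromBlocks_multiply]

/-- The unitary `1 ⊕ (-1)`. -/
def blockSign (n : Type*) [Fintype n] [DecidableEq n] :
    unitary (Matrix (n ⊕ n) (n ⊕ n) ℂ) :=
  ⟨fromBlocks 1 0 0 (-1), by
    rw [Unitary.mem_iff]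
    simp [star_eq_conjTranspose, fromBlocks_conjTranspose, fromBlocks_multiply]⟩

theorem blockSign_conj_apply (X : Matrix (n ⊕ n) (n ⊕ n) ℂ) :
    Unitary.conjStarAlgAut ℝ _ (blockSign n) X =
      fromBlocks X.toBlocks₁₁ (-X.toBlocks₁₂) (-X.toBlocks₂₁) X.toBlocks₂₂ := by
  rw [Unitary.conjStarAlgAut_apply]
  conv_lhs => rw [← fromBlocks_toBlocks X]
  simp [blockSign, star_eq_conjTranspose, fromBlocks_conjTranspose, fromBlocks_multiply]

/-- Conjugation by `1 ⊕ (-1)` negates the off-diagonal blocks, hence the dilation, and fixes the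
diagonal blocks of any matrix. -/
theorem cfc_neg_hermDilation (f : ℝ → ℝ) (A : Matrix n n ℂ) :
    cfc f (-hermDilation A) =
      Unitary.conjStarAlgAut ℝ _ (blockSign n) (cfc f (hermDilation A)) := by
  have h : Unitary.conjStarAlgAut ℝ _ (blockSign n) (hermDilation A) = -hermDilation A := by
    rw [blockSign_conj_apply]
    simp [hermDilation, fromBlocks_neg]
  have hcont : Continuous (Unitary.conjStarAlgAut ℝ (Matrix (n ⊕ n) (n ⊕ n) ℂ) (blockSign n)) := by
    rw [show ⇑(Unitary.conjStarAlgAut ℝ (Matrix (n ⊕ n) (n ⊕ n) ℂ) (blockSign n)) = fun X =>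
      (blockSign n : Matrix (n ⊕ n) (n ⊕ n) ℂ) * X * star (blockSign n : Matrix _ _ ℂ) from
      funext fun X => Unitary.conjStarAlgAut_apply _ X]
    fun_prop
  have hH := (isHermitian_hermDilation A).isSelfAdjoint
  rw [StarAlgHomClass.map_cfc (S := ℝ) (Unitary.conjStarAlgAut ℝ _ (blockSign n)) f
    (hermDilation A) (continuousOn_spectrum _ _) hcont hH (hH.map _), h]

theorem toBlocks₁₁_cfc_neg_hermDilation (f : ℝ → ℝ) (A : Matrix n n ℂ) :
    (cfc f (-hermDilation A)).toBlocks₁₁ = (cfc f (hermDilation A)).toBlocks₁₁ := by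
  rw [cfc_neg_hermDilation, blockSign_conj_apply, toBlocks_fromBlocks₁₁]

theorem toBlocks₂₂_cfc_neg_hermDilation (f : ℝ → ℝ) (A : Matrix n n ℂ) :
    (cfc f (-hermDilation A)).toBlocks₂₂ = (cfc f (hermDilation A)).toBlocks₂₂ := by
  rw [cfc_neg_hermDilation, blockSign_conj_apply, toBlocks_fromBlocks₂₂]

theorem reTrace_cfc_neg_hermDilation (f : ℝ → ℝ) (A : Matrix n n ℂ) :
    reTrace (cfc f (-hermDilation A)) = reTrace (cfc f (hermDilation A)) := by
  rw [cfc_neg_hermDilation, Unitary.conjStarAlgAut_apply, reTrace_mul_comm, ← mul_assoc,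
    Unitary.coe_star_mul_self, one_mul]

theorem cfc_posPart_add_cfc_neg {f : ℝ → ℝ} (hf0 : f 0 = 0) {H : Matrix n n ℂ}
    (hH : H.IsHermitian) :
    cfc (fun t => f (max t 0)) H + cfc (fun t => f (max t 0)) (-H) =
      cfc (fun t => f √t) (H * H) := by
  rw [cfc_neg_eq _ hH, ← matrix_cfc_add, ← cfc_comp_abs_eq f hH]
  refine cfc_congr fun t _ => ?_
  rcases le_total 0 t with h | h
  · simp [h, abs_of_nonneg, hf0]
  · simp [h, abs_of_nonpos, hf0]

/-- For the dilation `H`, `f(H₊) + f(H₋) = f(|H|)`, which by normality is `f |A| ⊕ f |A|`. The two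
summands have the same diagonal blocks, so each carries half. -/
theorem cfc_posPart_hermDilation_blocks {f : ℝ → ℝ} (hf0 : f 0 = 0) {A : Matrix n n ℂ}
    (hA : IsStarNormal A) :
    (2 : ℝ) • (cfc (fun t => f (max t 0)) (hermDilation A)).toBlocks₁₁ = cfc f (CFC.abs A) ∧
    (2 : ℝ) • (cfc (fun t => f (max t 0)) (hermDilation A)).toBlocks₂₂ = cfc f (CFC.abs A) := by
  have h := cfc_posPart_add_cfc_neg hf0 (isHermitian_hermDilation A)
  have hnormal : A * Aᴴ = Aᴴ * A := hA.star_comm_self.eq.symm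
  rw [hermDilation_mul_self, hnormal,
    cfc_fromBlocks_self _ (isHermitian_conjTranspose_mul_self A), ← cfc_abs_eq] at h
  constructor
  · rw [two_smul]
    nth_rewrite 2 [← toBlocks₁₁_cfc_neg_hermDilation]
    exact (congrArg toBlocks₁₁ h).trans (toBlocks_fromBlocks₁₁ _ _ _ _)
  · rw [two_smul]
    nth_rewrite 2 [← toBlocks₂₂_cfc_neg_hermDilation]
    exact (congrArg toBlocks₂₂ h).trans (toBlocks_fromBlocks₂₂ _ _ _ _)

/-- The positive part of the dilation carries each nonzero singular value of `M` once, and `ψ 0 = 0`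
discards the rest. No normality is needed, which matters because `A + B` need not be normal. -/
theorem reTrace_cfc_abs {ψ : ℝ → ℝ} (hψ : ψ 0 = 0) (M : Matrix n n ℂ) :
    reTrace (cfc ψ (CFC.abs M)) = reTrace (cfc (fun t => ψ (max t 0)) (hermDilation M)) := by
  have h := congrArg reTrace (cfc_posPart_add_cfc_neg hψ (isHermitian_hermDilation M))
  rw [map_add, reTrace_cfc_neg_hermDilation, hermDilation_mul_self,
    reTrace_cfc_fromBlocks (isHermitian_mul_conjTranspose_self M)
      (isHermitian_conjTranspose_mul_self M),
    ← reTrace_cfc_conjTranspose_mul_comm M (by simpa using hψ), ← cfc_abs_eq] at h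
  linarith

end Dilation

/-! ### The inequality for normal matrices when `f 0 = 0`. -/

section NormalSubadditivity

variable {n : Type*} [Fintype n] [DecidableEq n]

/-- Weak majorization of `f |A + B|` by `f |A| + f |B|` for normal `A`, `B` and concave `f`
vanishing at `0`. -/
theorem excess_cfc_abs_add_le {A B : Matrix n n ℂ} (hA : IsStarNormal A) (hB : IsStarNormal B)
    {f : ℝ → ℝ} (hf_nonneg : ∀ t ∈ Set.Ici (0 : ℝ), 0 ≤ f t)
    (hf : ConcaveOn ℝ (Set.Ici (0 : ℝ)) f) (hf0 : f 0 = 0) {r : ℝ} (hr : 0 ≤ r) :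
    excess r (cfc f (CFC.abs (A + B))) ≤ excess r (cfc f (CFC.abs A) + cfc f (CFC.abs B)) := by
  set ψ : ℝ → ℝ := fun t => max (f t - r) 0 with hψ
  have hψ0 : ψ 0 = 0 := by simp [hψ, hf0, hr]
  have hmono := hf.monotoneOn_of_nonneg hf_nonneg
  have hψmono : Monotone fun t => ψ (max t 0) := fun x y hxy =>
    max_le_max (sub_le_sub_right (hmono (le_max_right x 0 : (0 : ℝ) ≤ max x 0)
      (le_max_right y 0 : (0 : ℝ) ≤ max y 0) (max_le_max hxy le_rfl)) r) le_rfl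
  have habs : (CFC.abs (A + B)).IsHermitian :=
    (nonneg_iff_posSemidef.1 (CFC.abs_nonneg (A + B))).isHermitian
  set H := hermDilation A with hH
  set G := hermDilation B with hG
  have hHH : H.IsHermitian := isHermitian_hermDilation A
  have hGH : G.IsHermitian := isHermitian_hermDilation B
  set P := cfc (fun t : ℝ => max t 0) H with hP
  set Q := cfc (fun t : ℝ => max t 0) G with hQ
  have hPpos : P.PosSemidef := posSemidef_cfc fun _ _ => le_max_right _ _
  have hQpos : Q.PosSemidef := posSemidef_cfc fun _ _ => le_max_right _ _
  have hle : ∀ {K : Matrix (n ⊕ n) (n ⊕ n) ℂ}, K.IsHermitian →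
      (cfc (fun t : ℝ => max t 0) K - K).PosSemidef := by
    intro K hK
    nth_rewrite 2 [← matrix_cfc_id hK]
    exact posSemidef_cfc_sub fun t _ => le_max_left t 0
  -- `H + G ≤ H₊ + G₊`; under the trace, monotonicity of `t ↦ ψ (max t 0)` suffices, operator
  -- monotonicity is not required.
  have h1 : reTrace (cfc (fun t => ψ (max t 0)) (H + G)) ≤
      reTrace (cfc (fun t => ψ (max t 0)) (P + Q)) := by
    refine reTrace_cfc_mono (hHH.add hGH) (hPpos.add hQpos).isHermitian ?_ hψmono
    have := (hle hHH).add (hle hGH)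
    rwa [sub_add_sub_comm] at this
  have h2 : reTrace (cfc (fun t => ψ (max t 0)) (P + Q)) = excess r (cfc f (P + Q)) := by
    rw [excess, ← matrix_cfc_comp _ f (hPpos.add hQpos).isHermitian]
    congr 1
    refine cfc_congr fun t ht => ?_
    simp only [hψ, max_eq_left (spectrum_nonneg (hPpos.add hQpos) ht)]
  have h3 := excess_cfc_add_le hPpos hQpos hf_nonneg hf hf0 r
  rw [hP, hQ, ← matrix_cfc_comp f _ hHH, ← matrix_cfc_comp f _ hGH] at h3
  have hq : ∀ t, 0 ≤ f (max t 0) := fun t => hf_nonneg _ (le_max_right t 0)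
  obtain ⟨hA1, hA2⟩ := cfc_posPart_hermDilation_blocks hf0 hA
  obtain ⟨hB1, hB2⟩ := cfc_posPart_hermDilation_blocks hf0 hB
  have h4 := excess_le_of_toBlocks
    (X := cfc (fun t => f (max t 0)) H + cfc (fun t => f (max t 0)) G)
    (Z := cfc f (CFC.abs A) + cfc f (CFC.abs B))
    ((posSemidef_cfc fun t _ => hq t).add (posSemidef_cfc fun t _ => hq t))
    (by rw [← hA1, ← hB1, ← smul_add]; rfl) (by rw [← hA2, ← hB2, ← smul_add]; rfl) hr
  have h5 : excess r (cfc f (CFC.abs (A + B))) =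
      reTrace (cfc (fun t => ψ (max t 0)) (H + G)) := by
    rw [hH, hG, ← hermDilation_add, ← reTrace_cfc_abs hψ0, excess,
      ← matrix_cfc_comp (fun t => max (t - r) 0) f habs]
  linarith

end NormalSubadditivity

/-! ### Weak majorization of real vectors. -/

section WeakMajorization

/-- Abel summation; keeping the boundary term on the left makes the induction close. -/
theorem mul_sum_range_le_sum_mul {a d : ℕ → ℝ} (ha : Antitone a) (N : ℕ)
    (hd : ∀ k ≤ N, 0 ≤ ∑ i ∈ Finset.range k, d i) :
    a N * ∑ i ∈ Finset.range N, d i ≤ ∑ i ∈ Finset.range N, a i * d i := by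
  induction N with
  | zero => simp
  | succ N ih =>
    have h1 := ih fun k hk => hd k (hk.trans N.le_succ)
    have h2 := hd (N + 1) le_rfl
    have h3 := mul_le_mul_of_nonneg_right (ha N.le_succ) h2
    rw [Finset.sum_range_succ] at h3 ⊢
    rw [Finset.sum_range_succ]
    linarith

theorem sum_range_le_of_excess_le {x y : ℕ → ℝ} (hy : Antitone y) (hy0 : ∀ i, 0 ≤ y i) {N : ℕ}
    (h : ∀ r, 0 ≤ r → ∑ i ∈ Finset.range N, max (x i - r) 0 ≤
      ∑ i ∈ Finset.range N, max (y i - r) 0) {k : ℕ} (hk : k ≤ N) :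
    ∑ i ∈ Finset.range k, x i ≤ ∑ i ∈ Finset.range k, y i := by
  -- At threshold `y k` exactly the first `k` terms of the sorted `y` contribute to its excess,
  -- while dropping terms and positive parts only lowers that of `x`.
  have h1 := h (y k) (hy0 k)
  have h2 : ∑ i ∈ Finset.range k, (x i - y k) ≤ ∑ i ∈ Finset.range N, max (x i - y k) 0 :=
    (Finset.sum_le_sum fun i _ => le_max_left _ _).trans
      (Finset.sum_le_sum_of_subset_of_nonneg (Finset.range_mono hk) fun i _ _ => le_max_right _ _)
  have h3 : ∑ i ∈ Finset.range N, max (y i - y k) 0 = ∑ i ∈ Finset.range k, (y i - y k) := by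
    rw [← Finset.sum_subset (Finset.range_mono hk)]
    · refine Finset.sum_congr rfl fun i hi => max_eq_left (sub_nonneg.2 (hy ?_))
      exact (Finset.mem_range.1 hi).le
    · intro i _ hi
      exact max_eq_right (sub_nonpos.2 (hy (not_lt.1 fun hlt => hi (Finset.mem_range.2 hlt))))
  rw [h3] at h1
  have h4 := h2.trans h1
  rw [Finset.sum_sub_distrib, Finset.sum_sub_distrib] at h4
  linarith

variable {ι : Type*} [Fintype ι]

theorem exists_equiv_antitone (g : ι → ℝ) :
    ∃ e : Fin (Fintype.card ι) ≃ ι, Antitone (g ∘ e) := by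
  set e₀ := (Fintype.equivFin ι).symm
  refine ⟨(Tuple.sort fun i => -g (e₀ i)).trans e₀, fun i j hij => ?_⟩
  have := Tuple.monotone_sort (fun i => -g (e₀ i)) hij
  simpa using this

/-- The extension by zero of a finite sequence. -/
noncomputable def extendZero {N : ℕ} (v : Fin N → ℝ) (i : ℕ) : ℝ :=
  if h : i < N then v ⟨i, h⟩ else 0

theorem extendZero_coe {N : ℕ} (v : Fin N → ℝ) (i : Fin N) : extendZero v i = v i := by
  simp [extendZero]

theorem extendZero_nonneg {N : ℕ} {v : Fin N → ℝ} (hv : ∀ i, 0 ≤ v i) (i : ℕ) :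
    0 ≤ extendZero v i := by
  unfold extendZero
  split_ifs
  exacts [hv _, le_rfl]

theorem antitone_extendZero {N : ℕ} {v : Fin N → ℝ} (hv : Antitone v) (hv0 : ∀ i, 0 ≤ v i) :
    Antitone (extendZero v) := by
  intro i j hij
  by_cases hj : j < N
  · rw [extendZero, extendZero, dif_pos hj, dif_pos (hij.trans_lt hj)]
    exact hv hij
  · rw [extendZero, dif_neg hj]
    exact extendZero_nonneg hv0 i

theorem sum_range_extendZero {N : ℕ} (v : Fin N → ℝ) (F : ℝ → ℝ) :
    ∑ i ∈ Finset.range N, F (extendZero v i) = ∑ i, F (v i) := by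
  rw [Finset.sum_range]
  simp only [extendZero_coe]

/-- A nonnegative vector `x` weakly majorized by `y` lies in the convex hull of the signed
permutations of `y`. -/
theorem mem_convexHull_signed_perm {x y : ι → ℝ} (hx : ∀ i, 0 ≤ x i) (hy : ∀ i, 0 ≤ y i)
    (h : ∀ r, 0 ≤ r → ∑ i, max (x i - r) 0 ≤ ∑ i, max (y i - r) 0) :
    x ∈ convexHull ℝ (Set.range fun p : Equiv.Perm ι × (ι → ℤˣ) =>
      fun i => ((p.2 i : ℤ) : ℝ) * y (p.1 i)) := by
  classical
  by_contra hmem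
  have hfin := Set.finite_range fun p : Equiv.Perm ι × (ι → ℤˣ) =>
      fun i => ((p.2 i : ℤ) : ℝ) * y (p.1 i)
  obtain ⟨φ, u, hlt, hgt⟩ := geometric_hahn_banach_closed_point (convex_convexHull ℝ _)
    (hfin.isClosed_convexHull ℝ) hmem
  set w : ι → ℝ := fun i => φ (fun j => if i = j then 1 else 0) with hw
  have hφ : ∀ v, φ v = ∑ i, v i * w i := fun v => by
    have := LinearMap.pi_apply_eq_sum_univ φ.toLinearMap v
    simpa [hw] using this
  obtain ⟨e₁, he₁⟩ := exists_equiv_antitone fun i => |w i|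
  obtain ⟨e₂, he₂⟩ := exists_equiv_antitone y
  -- Among signed permutations of `y`, the separating functional is largest when the largest `|w|`
  -- meets the largest `y` and the signs match those of `w`.
  set σ : Equiv.Perm ι := e₁.symm.trans e₂
  set ε : ι → ℤˣ := fun i => if 0 ≤ w i then 1 else -1 with hε
  have hεw : ∀ i, ((ε i : ℤ) : ℝ) * w i = |w i| := by
    intro i
    by_cases hi : 0 ≤ w i
    · simp [hε, hi, abs_of_nonneg]
    · simp [hε, hi, abs_of_neg (not_le.1 hi)]
  have h1 := hlt _ (subset_convexHull ℝ _ ⟨(σ, ε), rfl⟩)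
  have h2 : φ (fun i => ((ε i : ℤ) : ℝ) * y (σ i)) = ∑ j, |w (e₁ j)| * y (e₂ j) := by
    rw [hφ, ← e₁.sum_comp]
    refine Finset.sum_congr rfl fun j _ => ?_
    rw [← hεw]
    simp only [σ, Equiv.trans_apply, Equiv.symm_apply_apply]
    ring
  have h3 : φ x ≤ ∑ j, |w (e₁ j)| * x (e₁ j) := by
    rw [hφ, ← e₁.sum_comp]
    refine Finset.sum_le_sum fun j _ => ?_
    rw [mul_comm]
    exact mul_le_mul_of_nonneg_right (le_abs_self _) (hx _)
  -- Extension by zero keeps nonnegative decreasing sequences decreasing, and supplies the threshold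
  -- `0` for the full sum.
  set a := extendZero fun j => |w (e₁ j)|
  set xs := extendZero fun j => x (e₁ j)
  set ys := extendZero fun j => y (e₂ j)
  have ha0 : ∀ i, 0 ≤ a i := extendZero_nonneg fun _ => abs_nonneg _
  have ha : Antitone a := antitone_extendZero he₁ fun _ => abs_nonneg _
  have hys : Antitone ys := antitone_extendZero he₂ fun _ => hy _
  have hpart : ∀ k ≤ Fintype.card ι, 0 ≤ ∑ i ∈ Finset.range k, (ys i - xs i) := by
    intro k hk
    rw [Finset.sum_sub_distrib, sub_nonneg]
    refine sum_range_le_of_excess_le hys (extendZero_nonneg fun _ => hy _) (fun r hr => ?_) hk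
    rw [sum_range_extendZero (fun j => x (e₁ j)) fun t => max (t - r) 0,
      sum_range_extendZero (fun j => y (e₂ j)) fun t => max (t - r) 0,
      e₁.sum_comp fun i => max (x i - r) 0, e₂.sum_comp fun i => max (y i - r) 0]
    exact h r hr
  have h4 := mul_sum_range_le_sum_mul ha _ hpart
  have h5 := mul_nonneg (ha0 (Fintype.card ι)) (hpart _ le_rfl)
  have h6 : ∑ i ∈ Finset.range (Fintype.card ι), a i * (ys i - xs i) =
      ∑ j, |w (e₁ j)| * y (e₂ j) - ∑ j, |w (e₁ j)| * x (e₁ j) := by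
    rw [Finset.sum_range, ← Finset.sum_sub_distrib]
    refine Finset.sum_congr rfl fun j _ => ?_
    simp only [a, xs, ys, extendZero_coe]
    ring
  linarith

end WeakMajorization

/-! ### Symmetric norms and Ky Fan dominance. -/

section SymmetricNorm

variable {n : Type*} [Fintype n] [DecidableEq n]

theorem permMatrix_mem_unitaryGroup (σ : Equiv.Perm n) :
    σ.permMatrix ℂ ∈ unitaryGroup n ℂ := by
  rw [mem_unitaryGroup_iff, star_eq_conjTranspose, conjTranspose_permMatrix, ← permMatrix_mul]
  simp

/-- Permutation matrices and diagonal sign matrices are unitary. -/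
theorem IsSymmetricNorm.map_diagonal_signed_perm {N : Seminorm ℂ (Matrix n n ℂ)}
    (hN : IsSymmetricNorm N) (y : n → ℝ) (σ : Equiv.Perm n) (ε : n → ℤˣ) :
    N (diagonal fun i => ((((ε i : ℤ) : ℝ) * y (σ i) : ℝ) : ℂ)) =
      N (diagonal fun i => (y i : ℂ)) := by
  have hD : diagonal (fun i => ((ε i : ℤ) : ℂ)) ∈ unitaryGroup n ℂ := by
    rw [mem_unitaryGroup_iff, star_eq_conjTranspose, diagonal_conjTranspose, diagonal_mul_diagonal,
      ← diagonal_one]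
    congr 1
    ext i
    rcases Int.units_eq_one_or (ε i) with h | h <;> simp [h]
  have hσ := permMatrix_mem_unitaryGroup σ
  have h : diagonal (fun i => ((((ε i : ℤ) : ℝ) * y (σ i) : ℝ) : ℂ)) =
      (diagonal (fun i => ((ε i : ℤ) : ℂ)) * σ.permMatrix ℂ) * diagonal (fun i => (y i : ℂ)) *
        star (σ.permMatrix ℂ) := by
    rw [star_eq_conjTranspose, conjTranspose_permMatrix, mul_assoc, mul_assoc,
      ← mul_assoc (σ.permMatrix ℂ), Equiv.Perm.permMatrix, Equiv.Perm.permMatrix,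
      PEquiv.toMatrix_toPEquiv_mul, PEquiv.mul_toMatrix_toPEquiv]
    ext i j
    by_cases hij : i = j
    · subst hij
      simp [Equiv.Perm.inv_def]
    · simp [hij, Equiv.Perm.inv_def]
  rw [h]
  exact hN.map_unitary_mul_mul_unitary _ _ (mul_mem hD hσ) _ (Unitary.star_mem hσ)

theorem IsSymmetricNorm.map_eq_map_diagonal {N : Seminorm ℂ (Matrix n n ℂ)}
    (hN : IsSymmetricNorm N) {X : Matrix n n ℂ} (hX : X.IsHermitian) :
    N X = N (diagonal fun i => (hX.eigenvalues i : ℂ)) := by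
  conv_lhs => rw [hX.spectral_theorem, Unitary.conjStarAlgAut_apply]
  exact hN.map_unitary_mul_mul_unitary _ _ hX.eigenvectorUnitary.2 _
    (Unitary.star_mem hX.eigenvectorUnitary.2)

/-- The **Ky Fan dominance principle**: symmetric norms respect weak majorization. -/
theorem IsSymmetricNorm.le_of_excess_le {N : Seminorm ℂ (Matrix n n ℂ)}
    (hN : IsSymmetricNorm N) {X Y : Matrix n n ℂ} (hX : X.PosSemidef) (hY : Y.PosSemidef)
    (h : ∀ r, 0 ≤ r → excess r X ≤ excess r Y) : N X ≤ N Y := by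
  rw [hN.map_eq_map_diagonal hX.isHermitian, hN.map_eq_map_diagonal hY.isHermitian]
  set x := hX.isHermitian.eigenvalues
  set y := hY.isHermitian.eigenvalues
  let D : (n → ℝ) →ₗ[ℝ] Matrix n n ℂ :=
    { toFun := fun v => diagonal fun i => (v i : ℂ)
      map_add' := fun v w => by simp [diagonal_add]
      map_smul' := fun c v => by
        ext i j
        by_cases hij : i = j <;> simp [hij] }
  have hmem := mem_convexHull_signed_perm hX.eigenvalues_nonneg hY.eigenvalues_nonneg
    fun r hr => by
      have := h r hr
      rwa [excess, excess, reTrace_cfc_eq_sum hX.isHermitian,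
        reTrace_cfc_eq_sum hY.isHermitian] at this
  -- This sublevel set of the norm contains all signed permutations of `y`, so by convexity it
  -- contains their hull, and with it `x`.
  have hconv : Convex ℝ {v : n → ℝ | N (D v) ≤ N (D y)} := by
    intro v hv w hw a b ha hb hab
    simp only [Set.mem_ofPred_eq] at hv hw ⊢
    have hsmul : ∀ {c : ℝ}, 0 ≤ c → ∀ M : Matrix n n ℂ, N (c • M) = c * N M := by
      intro c hc M
      rw [← Complex.coe_smul, map_smul_eq_mul, Complex.norm_real, Real.norm_of_nonneg hc]
    calc N (D (a • v + b • w)) ≤ N (a • D v) + N (b • D w) := by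
          rw [map_add, map_smul, map_smul]
          exact map_add_le_add N _ _
      _ = a * N (D v) + b * N (D w) := by rw [hsmul ha, hsmul hb]
      _ ≤ a * N (D y) + b * N (D y) :=
          add_le_add (mul_le_mul_of_nonneg_left hv ha) (mul_le_mul_of_nonneg_left hw hb)
      _ = N (D y) := by rw [← add_mul, hab, one_mul]
  refine convexHull_min ?_ hconv hmem
  rintro _ ⟨⟨σ, ε⟩, rfl⟩
  exact (hN.map_diagonal_signed_perm y σ ε).le

end SymmetricNorm

/-! ### Removal of the condition `f 0 = 0`, and the conclusion. -/

/-- With `c = f 0` and `g = f - c`, the left side is shifted by `c` and the right side by `2c`; as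
`c ≥ 0`, the extra `c` only helps. -/
theorem excess_cfc_abs_add_le_of_concaveOn {n : Type*} [Fintype n] [DecidableEq n]
    {A B : Matrix n n ℂ} (hA : IsStarNormal A) (hB : IsStarNormal B)
    {f : ℝ → ℝ} (hf_nonneg : ∀ t ∈ Set.Ici (0 : ℝ), 0 ≤ f t)
    (hf : ConcaveOn ℝ (Set.Ici (0 : ℝ)) f) (r : ℝ) :
    excess r (cfc f (CFC.abs (A + B))) ≤ excess r (cfc f (CFC.abs A) + cfc f (CFC.abs B)) := by
  set c := f 0 with hc
  have hc0 : 0 ≤ c := hf_nonneg 0 Set.self_mem_Ici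
  set g : ℝ → ℝ := fun t => f t - c with hg
  have hg_nonneg : ∀ t ∈ Set.Ici (0 : ℝ), 0 ≤ g t := fun t ht =>
    sub_nonneg.2 (hf.monotoneOn_of_nonneg hf_nonneg Set.self_mem_Ici ht ht)
  have hg_concave : ConcaveOn ℝ (Set.Ici (0 : ℝ)) g :=
    hf.sub (convexOn_const c hf.1)
  have hg0 : g 0 = 0 := sub_self _
  have habs : ∀ M : Matrix n n ℂ, (CFC.abs M).PosSemidef := fun M =>
    nonneg_iff_posSemidef.1 (CFC.abs_nonneg M)
  have hfg : ∀ M : Matrix n n ℂ,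
      cfc f (CFC.abs M) = cfc g (CFC.abs M) + c • (1 : Matrix n n ℂ) := by
    intro M
    rw [hg, matrix_cfc_sub, matrix_cfc_const c (habs M).isHermitian, sub_add_cancel]
  have hgpos : ∀ M : Matrix n n ℂ, (cfc g (CFC.abs M)).PosSemidef := fun M =>
    posSemidef_cfc fun t ht => hg_nonneg t (spectrum_nonneg (habs M) ht)
  set Z := cfc g (CFC.abs A) + cfc g (CFC.abs B) with hZ
  have hZpos : Z.PosSemidef := (hgpos A).add (hgpos B)
  have h1 : ∀ s, excess s (cfc g (CFC.abs (A + B))) ≤ excess s Z := by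
    intro s
    rcases le_total 0 s with hs | hs
    · exact excess_cfc_abs_add_le hA hB hg_nonneg hg_concave hg0 hs
    -- The shifted threshold `r - c` may be negative; there the excess of a positive matrix is its
    -- trace plus a constant, so the case of threshold `0` suffices.
    · have h := excess_cfc_abs_add_le hA hB hg_nonneg hg_concave hg0 le_rfl
      rw [excess_of_nonpos le_rfl (hgpos _), excess_of_nonpos le_rfl hZpos] at h
      rw [excess_of_nonpos hs (hgpos _), excess_of_nonpos hs hZpos]
      linarith
  have hZ2 : cfc f (CFC.abs A) + cfc f (CFC.abs B) = Z + (2 * c) • (1 : Matrix n n ℂ) := by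
    rw [hfg, hfg, hZ, two_mul, add_smul]
    abel
  rw [hZ2, hfg, excess_add_smul_one r c (hgpos _).isHermitian,
    excess_add_smul_one r (2 * c) hZpos.isHermitian]
  refine (h1 (r - c)).trans ?_
  have h2 : excess (r - c) Z ≤ excess (r - 2 * c) Z := by
    have := reTrace_nonneg (posSemidef_cfc_sub (X := Z) (f := fun t => max (t - (r - c)) 0)
      (g := fun t => max (t - (r - 2 * c)) 0) fun t _ => max_le_max (by linarith) le_rfl)
    rw [map_sub] at this
    unfold excess
    linarith
  exact h2

theorem corollary1p5 {n : Type*} [Fintype n] [DecidableEq n]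
    (A B : Matrix n n ℂ) (hA : IsStarNormal A) (hB : IsStarNormal B)
    (f : ℝ → ℝ) (hf_nonneg : ∀ t ∈ Set.Ici (0 : ℝ), 0 ≤ f t)
    (hf_concave : ConcaveOn ℝ (Set.Ici (0 : ℝ)) f) (hf_econvex : EConvex f)
    (N : Seminorm ℂ (Matrix n n ℂ)) (hN : IsSymmetricNorm N) :
    N (cfc f (CFC.abs (A + B))) ≤ N (cfc f (CFC.abs A) + cfc f (CFC.abs B)) := by
  have hpos : ∀ M : Matrix n n ℂ, (cfc f (CFC.abs M)).PosSemidef := fun M =>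
    posSemidef_cfc fun t ht =>
      hf_nonneg t (spectrum_nonneg (nonneg_iff_posSemidef.1 (CFC.abs_nonneg M)) ht)
  exact hN.le_of_excess_le (hpos _) ((hpos A).add (hpos B)) fun r _ =>
    excess_cfc_abs_add_le_of_concaveOn hA hB hf_nonneg hf_concave r
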